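/- Let $n\ge 1$. Let $A$ be a real $n\times n$ matrix all of whose (complex) eigenvalues have positive real parts. Let $G:\mathbb{R}^n\to\mathbb{R}^n$ be locally Lipschitz, and suppose there are maps $G_m:\mathbb{R}^n\to\mathbb{R}^n$, $m\ge 2$, each a homogeneous polynomial of degree $m$, such that for every $N\ge 2$ there is $\delta>0$ with $$\Big|G(x)-\sum_{m=2}^N G_m(x)\Big|=\mathcal O(|x|^{N+\delta})\quad\text{as } x\to 0.$$ Let $(\mu_k)_{k=1}^\infty$ be a strictly increasing, divergent sequence of positive numbers such that the set $\mathcal S=\{\mu_k:k\ge 1\}$ satisfies $a+b\in\mathcal S$ for all $a,b\in\mathcal S$, and contains the real part of every eigenvalue of $A$. An $\mathbb{R}^n$-valued S-polynomial is a function $\mathbb{R}\to\mathbb{R}^n$ that is a finite sum of functions of the form $t^m\cos(\omega t)Z$ and $t^m\sin(\omega t)Z$ with integers $m\ge 0$, $\omega\in\mathbb{R}$, and $Z\in\mathbb{R}^n$. For S-polynomials $\widehat g_k$ ($k\ge1$), write $g(t)\sim\sum_{k=1}^\infty \widehat g_k(t)e^{-\mu_k t}$ if for every $N\ge 1$ there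 is $\nu>\mu_N$ such that $$\Big|g(t)-\sum_{k=1}^N \widehat g_k(t)e^{-\mu_k t}\Big|=\mathcal O(e^{-\nu t})\quad\text{as } t\to\infty.$$ Let $f$ be an $\mathbb{R}^n$-valued function that is continuous on $[T_f,\infty)$ for some $T_f\ge 0$ and satisfies $$f(t)\sim\sum_{k=1}^\infty \widehat f_k(t)e^{-\mu_k t}\quad\text{with $\mathbb{R}^n$-valued S-polynomials } \widehat f_k .$$ Let $T_0\ge 0$, and let $y\in C^1((T_0,\infty);\mathbb{R}^n)$ be a solution of $$y'=-Ay+G(y)+f(t)\quad\text{on }(T_0,\infty)$$ with $y(t)\to 0$ as $t\to\infty$. Then there are $\mathbb{R}^n$-valued S-polynomials $\widehat q_k$, $k\ge 1$, such that $$y(t)\sim\sum_{k=1}^\infty \widehat q_k(t)e^{-\mu_k t}.$$ -/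

import Mathlib

/-- `P : ℝⁿ → ℝⁿ` is a homogeneous polynomial (map) of degree `m`: each of its components is a
homogeneous polynomial of degree `m` in the coordinates (the zero polynomial is allowed). -/
def IsHomogeneousPolynomialMap {n : ℕ} (m : ℕ)
    (P : EuclideanSpace ℝ (Fin n) → EuclideanSpace ℝ (Fin n)) : Prop :=
  ∃ p : Fin n → MvPolynomial (Fin n) ℝ,
    (∀ i, (p i).IsHomogeneous m) ∧
      ∀ (x : EuclideanSpace ℝ (Fin n)) (i : Fin n), P x i = MvPolynomial.eval (fun j => x j) (p i)

/-- `G(x) ∼ ∑_{m ≥ 2} G_m(x)` as `x → 0`, where each `G_m` is a homogeneous polynomial of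
degree `m`: for every `N ≥ 2` there is `δ > 0` with
`|G(x) - ∑_{m=2}^N G_m(x)| = O(|x|^{N+δ})` as `x → 0`. -/
def HasPolynomialExpansionAtZero {n : ℕ}
    (G : EuclideanSpace ℝ (Fin n) → EuclideanSpace ℝ (Fin n)) : Prop :=
  ∃ Gm : ℕ → EuclideanSpace ℝ (Fin n) → EuclideanSpace ℝ (Fin n),
    (∀ m, 2 ≤ m → IsHomogeneousPolynomialMap m (Gm m)) ∧
      ∀ N : ℕ, 2 ≤ N → ∃ δ : ℝ, 0 < δ ∧
        Asymptotics.IsBigO (nhds 0) (fun x => G x - ∑ m ∈ Finset.Icc 2 N, Gm m x)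
          (fun x => ‖x‖ ^ ((N : ℝ) + δ))

/-- `g : ℝ → X` is an `X`-valued S-polynomial: a finite sum of functions of the form
`t ↦ t^m cos(ω t) Z` and `t ↦ t^m sin(ω t) Z` with `m ∈ {0, 1, 2, …}`, `ω ∈ ℝ`, `Z ∈ X`. -/
def IsSPolynomial {X : Type*} [AddCommGroup X] [Module ℝ X] (g : ℝ → X) : Prop :=
  g ∈ AddSubmonoid.closure
    {h : ℝ → X | ∃ (m : ℕ) (ω : ℝ) (Z : X),
      h = (fun t => (t ^ m * Real.cos (ω * t)) • Z) ∨
        h = (fun t => (t ^ m * Real.sin (ω * t)) • Z)}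

/-- The remainder condition in `g(t) ∼ ∑_k ĝ_k(t) e^{-γ_k t}` as `t → ∞`: for every `N` there is
`ν > γ_N` with `‖g(t) - ∑_{k ≤ N} ĝ_k(t) e^{-γ_k t}‖ = O(e^{-ν t})`.
The sequences are indexed from `0`, so that index `k` here is the usual index `k + 1`. -/
def HasExpExpansion {X : Type*} [NormedAddCommGroup X] [NormedSpace ℝ X]
    (g : ℝ → X) (γ : ℕ → ℝ) (ghat : ℕ → ℝ → X) : Prop :=
  ∀ N : ℕ, ∃ ν : ℝ, γ N < ν ∧
    Asymptotics.IsBigO Filter.atTop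
      (fun t => g t - ∑ k ∈ Finset.range (N + 1), Real.exp (-γ k * t) • ghat k t)
      (fun t => Real.exp (-ν * t))

/-! After complexifying, consider finite sums of `t ^ m * exp (c t) • Z` whose decay rates `-Re c`
lie in `S`. `ExpApprox S g ρ` says that `g` is such a sum up to `O(exp (-ρ t))`. The theorem follows
once `y` is shown to have this property for every `ρ`.

The argument is a bootstrap. A small solution first decays like `exp (-ε t)` with `ε = μ 0 / 2`,
because `G(y) = o(y)` can be absorbed by the stable linear part
(`isBigO_exp_of_perturbed_linear_equation`). If `y` is known to order `ρ`, then `G(y)` is known to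
order `ρ + ε`: every term is at least quadratic, so an error in one factor is multiplied by another
that is `O(exp (-ε t))` (`ExpApprox.nonlinearity`). The linear equation passes this order on to `y`,
up to an arbitrarily small loss (`ExpApprox.of_linear_equation`). Iteration reaches every order.

The linear system is handled without matrix exponentials or Jordan forms. By Cayley-Hamilton a
product of factors `B - l` vanishes, and removing one factor at a time leaves scalar equations `w' =
-l w + h`.

The approximations at different orders fit into one series because an S-polynomial that tends to `0`
vanishes identically, so coefficients are unique (`hasExpExpansion_of_approximations`). -/

section Preliminaries

open Asymptotics Filter Topology

/-! ### Exponential polynomials and approximation by them. -/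

section ExpPoly

variable {W : Type*} [NormedAddCommGroup W] [NormedSpace ℂ W]

/-- The elementary function `t ↦ t ^ m e^{c t} Z`. -/
noncomputable def expMonomial (m : ℕ) (c : ℂ) (Z : W) : ℝ → W :=
  fun t => ((t : ℂ) ^ m * Complex.exp (c * t)) • Z

/-- Exponential polynomials whose frequencies `c` satisfy `-Re c ∈ S`. -/
def expPoly (S : Set ℝ) (W : Type*) [NormedAddCommGroup W] [NormedSpace ℂ W] :
    Submodule ℂ (ℝ → W) :=
  Submodule.span ℂ {h | ∃ (m : ℕ) (c : ℂ) (Z : W), -c.re ∈ S ∧ h = expMonomial m c Z}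

theorem expMonomial_mem {S : Set ℝ} {m : ℕ} {c : ℂ} (Z : W) (hc : -c.re ∈ S) :
    expMonomial m c Z ∈ expPoly S W :=
  Submodule.subset_span ⟨m, c, Z, hc, rfl⟩

theorem smul_expMonomial (a : ℂ) (m : ℕ) (c : ℂ) (Z : W) :
    a • expMonomial m c Z = expMonomial m c (a • Z) := by
  funext t
  simp only [expMonomial, Pi.smul_apply]
  rw [smul_comm]

theorem expPoly_clm {S : Set ℝ} {V : Type*} [NormedAddCommGroup V] [NormedSpace ℂ V]
    (L : W →L[ℂ] V) {p : ℝ → W} (hp : p ∈ expPoly S W) : (fun t => L (p t)) ∈ expPoly S V := by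
  induction hp using Submodule.span_induction with
  | mem x hx =>
    obtain ⟨m, c, Z, hc, rfl⟩ := hx
    convert expMonomial_mem (m := m) (L Z) hc using 1
    funext t
    simp [expMonomial]
  | zero =>
    simp only [Pi.zero_apply, map_zero]
    exact (expPoly S V).zero_mem
  | add x y _ _ hx hy =>
    simp only [Pi.add_apply, map_add]
    exact (expPoly S V).add_mem hx hy
  | smul a x _ hx =>
    simp only [Pi.smul_apply, map_smul]
    exact (expPoly S V).smul_mem a hx

/-- Multiplying exponentials adds their rates; this is where closure of `S` under addition enters.
-/
theorem expPoly_mul {S : Set ℝ} (hS : ∀ a ∈ S, ∀ b ∈ S, a + b ∈ S) {p q : ℝ → ℂ}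
    (hp : p ∈ expPoly S ℂ) (hq : q ∈ expPoly S ℂ) : (fun t => p t * q t) ∈ expPoly S ℂ := by
  induction hp using Submodule.span_induction with
  | mem x hx =>
    obtain ⟨m, c, Z, hc, rfl⟩ := hx
    induction hq using Submodule.span_induction with
    | mem x hx =>
      obtain ⟨m', c', Z', hc', rfl⟩ := hx
      have : -(c + c').re ∈ S := by
        have := hS _ hc _ hc'
        simpa [add_comm] using this
      convert expMonomial_mem (m := m + m') (Z * Z') this using 1
      funext t
      simp only [expMonomial, smul_eq_mul, add_mul, Complex.exp_add, pow_add]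
      ring
    | zero =>
      simp only [Pi.zero_apply, mul_zero]
      exact (expPoly S ℂ).zero_mem
    | add x y _ _ hx hy =>
      simp only [Pi.add_apply, mul_add]
      exact (expPoly S ℂ).add_mem hx hy
    | smul a x _ hx =>
      convert (expPoly S ℂ).smul_mem a hx using 1
      funext t
      simp only [Pi.smul_apply, smul_eq_mul]
      ring
  | zero =>
    simp only [Pi.zero_apply, zero_mul]
    exact (expPoly S ℂ).zero_mem
  | add x y _ _ hx hy =>
    simp only [Pi.add_apply, add_mul]
    exact (expPoly S ℂ).add_mem hx hy
  | smul a x _ hx =>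
    convert (expPoly S ℂ).smul_mem a hx using 1
    funext t
    simp only [Pi.smul_apply, smul_eq_mul]
    ring

theorem hasDerivAt_exp_mul (c : ℂ) (t : ℝ) :
    HasDerivAt (fun s : ℝ => Complex.exp (c * s)) (c * Complex.exp (c * t)) t := by
  have h : HasDerivAt (fun s : ℝ => c * (s : ℂ)) (c * 1) t :=
    Complex.ofRealCLM.hasDerivAt.const_mul c
  convert h.cexp using 1
  ring

theorem hasDerivAt_expMonomial_zero (c : ℂ) (Z : W) (t : ℝ) :
    HasDerivAt (expMonomial 0 c Z) (c • expMonomial 0 c Z t) t := by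
  have h := (hasDerivAt_exp_mul c t).smul_const Z
  convert h using 1
  · funext s; simp [expMonomial]
  · simp [expMonomial, smul_smul]

theorem hasDerivAt_expMonomial_succ (m : ℕ) (c : ℂ) (Z : W) (t : ℝ) :
    HasDerivAt (expMonomial (m + 1) c Z)
      (((m : ℂ) + 1) • expMonomial m c Z t + c • expMonomial (m + 1) c Z t) t := by
  have h0 : HasDerivAt (fun s : ℝ => (s : ℂ) ^ (m + 1)) (((m : ℂ) + 1) * (t : ℂ) ^ m) t := by
    have := (Complex.ofRealCLM.hasDerivAt (x := t)).fun_pow (m + 1)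
    simpa using this
  have h := (h0.mul (hasDerivAt_exp_mul c t)).smul_const Z
  refine h.congr_deriv ?_
  simp only [expMonomial, smul_smul, ← add_smul]
  congr 1
  ring

/-- The scalar linear equation `P' = -l P + p` has a particular solution of the same type. -/
theorem exists_particular_solution {S : Set ℝ} (l : ℂ) {p : ℝ → W} (hp : p ∈ expPoly S W) :
    ∃ P ∈ expPoly S W, ∀ t, HasDerivAt P (-(l • P t) + p t) t := by
  induction hp using Submodule.span_induction with
  | mem x hx =>
    obtain ⟨m, c, Z, hc, rfl⟩ := hx
    by_cases hl : c + l = 0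
    -- Resonance: the forcing frequency solves the homogeneous equation, so the power of `t` rises
    -- by one.
    · refine ⟨expMonomial (m + 1) c (((m : ℂ) + 1)⁻¹ • Z), expMonomial_mem _ hc, fun t => ?_⟩
      refine (hasDerivAt_expMonomial_succ m c _ t).congr_deriv ?_
      obtain rfl : l = -c := by linear_combination hl
      have hm : (m : ℂ) + 1 ≠ 0 := Nat.cast_add_one_ne_zero m
      rw [neg_smul, neg_neg, add_comm]
      congr 1
      rw [← smul_expMonomial, Pi.smul_apply, smul_smul, mul_inv_cancel₀ hm, one_smul]
    -- Without resonance, differentiating `t ^ (m + 1) * exp (c t)` leaves an extra term of degree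
    -- `m`, which the solution `P` for degree `m` corrects.
    · induction m with
      | zero =>
        refine ⟨expMonomial 0 c ((c + l)⁻¹ • Z), expMonomial_mem _ hc, fun t => ?_⟩
        refine (hasDerivAt_expMonomial_zero c _ t).congr_deriv ?_
        rw [eq_neg_add_iff_add_eq, ← add_smul, ← smul_expMonomial, Pi.smul_apply, smul_smul,
          add_comm l c, mul_inv_cancel₀ hl, one_smul]
      | succ m ih =>
        obtain ⟨P, hP, hd⟩ := ih
        refine ⟨(c + l)⁻¹ • (expMonomial (m + 1) c Z - ((m : ℂ) + 1) • P),
          Submodule.smul_mem _ _ (Submodule.sub_mem _ (expMonomial_mem _ hc)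
            (Submodule.smul_mem _ _ hP)), fun t => ?_⟩
        refine (((hasDerivAt_expMonomial_succ m c Z t).sub
          ((hd t).const_smul ((m : ℂ) + 1))).const_smul (c + l)⁻¹).congr_deriv ?_
        simp only [Pi.smul_apply, Pi.sub_apply]
        generalize expMonomial (m + 1) c Z t = u
        generalize expMonomial m c Z t = v
        generalize P t = w
        have : (c + l)⁻¹ * c = 1 - (c + l)⁻¹ * l := by
          field_simp; ring
        match_scalars
        · ring
        · linear_combination this
        · ring
  | zero =>
    refine ⟨0, Submodule.zero_mem _, fun t => ?_⟩
    simp [hasDerivAt_zero]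
  | add x y _ _ hx hy =>
    obtain ⟨P, hP, hd⟩ := hx
    obtain ⟨Q, hQ, he⟩ := hy
    refine ⟨P + Q, Submodule.add_mem _ hP hQ, fun t => ((hd t).add (he t)).congr_deriv ?_⟩
    simp only [Pi.add_apply, smul_add]
    abel
  | smul a x _ hx =>
    obtain ⟨P, hP, hd⟩ := hx
    refine ⟨a • P, Submodule.smul_mem _ _ hP, fun t => ((hd t).const_smul a).congr_deriv ?_⟩
    simp only [Pi.smul_apply, smul_add, smul_neg, smul_comm a l]

/-- `g` agrees with an exponential polynomial up to an error `O(e^{-ρ t})`. -/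
def ExpApprox (S : Set ℝ) (g : ℝ → W) (ρ : ℝ) : Prop :=
  ∃ p ∈ expPoly S W, (fun t => g t - p t) =O[atTop] fun t : ℝ => Real.exp (-ρ * t)

theorem exp_isBigO_exp {ρ ρ' : ℝ} (h : ρ' ≤ ρ) :
    (fun t : ℝ => Real.exp (-ρ * t)) =O[atTop] fun t : ℝ => Real.exp (-ρ' * t) := by
  refine IsBigO.of_bound 1 ?_
  filter_upwards [eventually_ge_atTop 0] with t ht
  rw [one_mul, Real.norm_eq_abs, Real.norm_eq_abs, Real.abs_exp, Real.abs_exp, Real.exp_le_exp]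
  nlinarith

theorem ExpApprox.mono {S : Set ℝ} {g : ℝ → W} {ρ ρ' : ℝ} (h : ExpApprox S g ρ) (hρ : ρ' ≤ ρ) :
    ExpApprox S g ρ' := by
  obtain ⟨p, hp, hg⟩ := h
  exact ⟨p, hp, hg.trans (exp_isBigO_exp hρ)⟩

theorem ExpApprox.of_isBigO {S : Set ℝ} {g : ℝ → W} {ρ : ℝ}
    (h : g =O[atTop] fun t : ℝ => Real.exp (-ρ * t)) : ExpApprox S g ρ :=
  ⟨0, Submodule.zero_mem _, by simpa using h⟩

theorem ExpApprox.of_mem {S : Set ℝ} {g : ℝ → W} {ρ : ℝ} (h : g ∈ expPoly S W) :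
    ExpApprox S g ρ :=
  ⟨g, h, by simpa using isBigO_zero _ _⟩

theorem ExpApprox.add {S : Set ℝ} {g h : ℝ → W} {ρ : ℝ} (hg : ExpApprox S g ρ)
    (hh : ExpApprox S h ρ) : ExpApprox S (fun t => g t + h t) ρ := by
  obtain ⟨p, hp, hgp⟩ := hg
  obtain ⟨q, hq, hhq⟩ := hh
  refine ⟨p + q, Submodule.add_mem _ hp hq, (hgp.add hhq).congr_left fun t => ?_⟩
  simp only [Pi.add_apply]
  abel

theorem ExpApprox.clm {S : Set ℝ} {V : Type*} [NormedAddCommGroup V] [NormedSpace ℂ V]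
    (L : W →L[ℂ] V) {g : ℝ → W} {ρ : ℝ} (hg : ExpApprox S g ρ) :
    ExpApprox S (fun t => L (g t)) ρ := by
  obtain ⟨p, hp, hgp⟩ := hg
  refine ⟨_, expPoly_clm L hp, ?_⟩
  refine ((L.isBigO_comp _ _).trans hgp).congr_left fun t => ?_
  rw [map_sub]

theorem ExpApprox.neg {S : Set ℝ} {g : ℝ → W} {ρ : ℝ} (hg : ExpApprox S g ρ) :
    ExpApprox S (fun t => -g t) ρ := by
  simpa using hg.clm (-ContinuousLinearMap.id ℂ W)

theorem ExpApprox.sub {S : Set ℝ} {g h : ℝ → W} {ρ : ℝ} (hg : ExpApprox S g ρ)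
    (hh : ExpApprox S h ρ) : ExpApprox S (fun t => g t - h t) ρ := by
  simpa [sub_eq_add_neg] using hg.add hh.neg

theorem ExpApprox.sum {S : Set ℝ} {ι : Type*} (s : Finset ι) {g : ι → ℝ → W} {ρ : ℝ}
    (hg : ∀ i ∈ s, ExpApprox S (g i) ρ) : ExpApprox S (fun t => ∑ i ∈ s, g i t) ρ := by
  classical
  induction s using Finset.induction_on with
  | empty => exact ExpApprox.of_mem (Submodule.zero_mem (expPoly S W))
  | insert a s ha ih =>
    simp only [Finset.sum_insert ha]
    exact (hg a (Finset.mem_insert_self a s)).add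
      (ih fun i hi => hg i (Finset.mem_insert_of_mem hi))

theorem ExpApprox.congr' {S : Set ℝ} {g h : ℝ → W} {ρ : ℝ} (hg : ExpApprox S g ρ)
    (e : g =ᶠ[atTop] h) : ExpApprox S h ρ := by
  obtain ⟨p, hp, hgp⟩ := hg
  exact ⟨p, hp, hgp.congr' (e.mono fun t ht => by simp only [ht]) EventuallyEq.rfl⟩

/-- With `p`, `q` approximating `g`, `h`, one has `g h - p q = (g - p) h + (h - q) g - (g - p) (h -
q)`. Only the decay of `g` and `h` is used, never that of `p` and `q`; the last product needs `ε ≤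
ρ`. -/
theorem ExpApprox.mul {S : Set ℝ} (hS : ∀ a ∈ S, ∀ b ∈ S, a + b ∈ S) {g h : ℝ → ℂ} {ε ρ : ℝ}
    (hερ : ε ≤ ρ) (hg : ExpApprox S g ρ) (hh : ExpApprox S h ρ)
    (hg' : g =O[atTop] fun t : ℝ => Real.exp (-ε * t))
    (hh' : h =O[atTop] fun t : ℝ => Real.exp (-ε * t)) :
    ExpApprox S (fun t => g t * h t) (ρ + ε) := by
  obtain ⟨p, hp, hgp⟩ := hg
  obtain ⟨q, hq, hhq⟩ := hh
  refine ⟨_, expPoly_mul hS hp hq, ?_⟩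
  have e : ∀ t : ℝ, Real.exp (-ρ * t) * Real.exp (-ε * t) = Real.exp (-(ρ + ε) * t) := fun t => by
    rw [← Real.exp_add]; congr 1; ring
  have h1 := (hgp.mul hh').congr_right e
  have h2 := (hhq.mul hg').congr_right e
  have h3 := (hgp.mul (hhq.trans (exp_isBigO_exp hερ))).congr_right e
  refine ((h1.add h2).sub h3).congr_left fun t => ?_
  ring

end ExpPoly

/-! ### Linear equations: scalar case, then systems by removing factors. -/

section LinearEquation

variable {W : Type*} [NormedAddCommGroup W] [NormedSpace ℂ W]

theorem norm_sub_le_of_norm_deriv_le_exp {v v' : ℝ → W} {C b s t : ℝ} (hb : b ≠ 0)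
    (hv : ∀ r ∈ Set.Icc s t, HasDerivAt v (v' r) r)
    (hv' : ∀ r ∈ Set.Icc s t, ‖v' r‖ ≤ C * Real.exp (b * r)) (hst : s ≤ t) :
    ‖v t - v s‖ ≤ C / b * (Real.exp (b * t) - Real.exp (b * s)) := by
  have hB : ∀ r, HasDerivAt (fun r => C / b * (Real.exp (b * r) - Real.exp (b * s)))
      (C * Real.exp (b * r)) r := fun r => by
    have h1 : HasDerivAt (fun r => b * r) (b * 1) r := (hasDerivAt_id r).const_mul b
    refine ((h1.exp.sub_const (Real.exp (b * s))).const_mul (C / b)).congr_deriv ?_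
    field_simp
  refine image_norm_le_of_norm_deriv_right_le_deriv_boundary (f := fun r => v r - v s) (f' := v')
    (fun r hr => ((hv r hr).sub_const _).continuousAt.continuousWithinAt)
    (fun r hr => ((hv r (Set.Ico_subset_Icc_self hr)).sub_const _).hasDerivWithinAt)
    (by simp) hB (fun r hr => hv' r (Set.Ico_subset_Icc_self hr)) (Set.right_mem_Icc.2 hst)

theorem hasDerivAt_integratingFactor {w : ℝ → W} {l : ℂ} {h : W} {t : ℝ}
    (hw : HasDerivAt w (-(l • w t) + h) t) :
    HasDerivAt (fun s : ℝ => Complex.exp (l * s) • w s) (Complex.exp (l * t) • h) t := by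
  refine ((hasDerivAt_exp_mul l t).smul hw).congr_deriv ?_
  module

theorem norm_exp_mul_ofReal (l : ℂ) (t : ℝ) :
    ‖Complex.exp (l * t)‖ = Real.exp (l.re * t) := by
  simp [Complex.norm_exp]

theorem isBigO_exp_of_integratingFactor {u : ℝ → W} {l : ℂ} {ρ K : ℝ}
    (h : ∀ᶠ t : ℝ in atTop, ‖Complex.exp (l * t) • u t‖ ≤ K * Real.exp ((l.re - ρ) * t)) :
    u =O[atTop] fun t : ℝ => Real.exp (-ρ * t) := by
  refine IsBigO.of_bound K ?_
  filter_upwards [h] with t ht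
  rw [norm_smul, norm_exp_mul_ofReal] at ht
  rw [Real.norm_eq_abs, Real.abs_exp]
  have e : Real.exp ((l.re - ρ) * t) = Real.exp (l.re * t) * Real.exp (-ρ * t) := by
    rw [← Real.exp_add]; congr 1; ring
  rw [e] at ht
  refine le_of_mul_le_mul_left (ht.trans_eq ?_) (Real.exp_pos (l.re * t))
  ring

/-- The function `v = exp (l t) u` has derivative `O(exp (b t))` with `b = Re l - ρ`. If `b < 0`,
`v` converges to some `c`, and `exp (-l t) c` is the approximation, of rate `Re l ∈ S`. If `b > 0`,
integration bounds `v` by `exp (b t)`, so `u` itself is of the size of the error. At `b = 0` a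
factor `t` could appear, hence `ρ ≠ l.re`. -/
theorem ExpApprox.of_scalar_equation_isBigO [CompleteSpace W] {S : Set ℝ} {l : ℂ}
    (hl : l.re ∈ S) {u R : ℝ → W} {ρ : ℝ} (hρ : ρ ≠ l.re)
    (hR : R =O[atTop] fun t : ℝ => Real.exp (-ρ * t))
    (hu : ∀ᶠ t in atTop, HasDerivAt u (-(l • u t) + R t) t) : ExpApprox S u ρ := by
  obtain ⟨C, hC0, hC⟩ := hR.exists_nonneg
  obtain ⟨T, hT⟩ := eventually_atTop.1 (hC.bound.and hu)
  have hb : l.re - ρ ≠ 0 := sub_ne_zero.2 hρ.symm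
  set b := l.re - ρ with hbdef
  set v : ℝ → W := fun s : ℝ => Complex.exp (l * s) • u s with hv
  have key : ∀ s t, T ≤ s → s ≤ t →
      ‖v t - v s‖ ≤ C / b * (Real.exp (b * t) - Real.exp (b * s)) := fun s t hs hst => by
    refine norm_sub_le_of_norm_deriv_le_exp hb
      (fun r hr => hasDerivAt_integratingFactor (hT r (hs.trans hr.1)).2) (fun r hr => ?_) hst
    have := (hT r (hs.trans hr.1)).1
    rw [Real.norm_eq_abs, Real.abs_exp] at this
    rw [norm_smul, norm_exp_mul_ofReal]
    refine (mul_le_mul_of_nonneg_left this (Real.exp_pos _).le).trans_eq ?_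
    have e : Real.exp (b * r) = Real.exp (l.re * r) * Real.exp (-ρ * r) := by
      rw [← Real.exp_add]; congr 1; ring
    rw [e]; ring
  rcases lt_or_gt_of_ne hb with hneg | hpos
  · have hcoef : 0 ≤ C / -b := div_nonneg hC0 (by linarith)
    have key' : ∀ s t, T ≤ s → s ≤ t → ‖v t - v s‖ ≤ C / -b * Real.exp (b * s) :=
      fun s t hs hst => by
        refine (key s t hs hst).trans ?_
        have h1 : C / b = -(C / -b) := by rw [div_neg, neg_neg]
        rw [h1]
        nlinarith [Real.exp_pos (b * t), mul_nonneg hcoef (Real.exp_pos (b * t)).le]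
    have htend : Tendsto (fun s : ℝ => C / -b * Real.exp (b * s)) atTop (𝓝 0) := by
      have h1 : Tendsto (fun s : ℝ => b * s) atTop atBot := tendsto_id.const_mul_atTop_of_neg hneg
      simpa using (Real.tendsto_exp_atBot.comp h1).const_mul (C / -b)
    -- The truncation `max T t` makes the estimate, valid only from `T` on, hold for all arguments.
    have hcau : CauchySeq fun t => v (max T t) := by
      refine cauchySeq_of_le_tendsto_0' (fun s => C / -b * Real.exp (b * max T s))
        (fun s t hst => ?_) ?_
      · rw [dist_comm, dist_eq_norm]
        exact key' _ _ (le_max_left _ _) (max_le_max le_rfl hst)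
      · refine htend.congr' ?_
        filter_upwards [eventually_ge_atTop T] with s hs
        rw [max_eq_right hs]
    obtain ⟨c, hc⟩ := cauchySeq_tendsto_of_complete hcau
    have hlim : Tendsto v atTop (𝓝 c) := hc.congr' (by
      filter_upwards [eventually_ge_atTop T] with s hs
      rw [max_eq_right hs])
    have hbd : ∀ s, T ≤ s → ‖v s - c‖ ≤ C / -b * Real.exp (b * s) := fun s hs => by
      rw [norm_sub_rev]
      exact le_of_tendsto (hlim.sub_const (v s)).norm
        ((eventually_ge_atTop s).mono fun t ht => key' s t hs ht)
    refine ⟨expMonomial 0 (-l) c, expMonomial_mem c (by simpa using hl), ?_⟩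
    refine isBigO_exp_of_integratingFactor (l := l) (K := C / -b) ?_
    filter_upwards [eventually_ge_atTop T] with t ht
    refine (le_of_eq ?_).trans (hbd t ht)
    congr 1
    rw [smul_sub, hv, expMonomial, smul_smul, pow_zero, one_mul, ← Complex.exp_add]
    simp
  · refine .of_isBigO (isBigO_exp_of_integratingFactor (l := l)
      (K := ‖v T‖ * Real.exp (-(b * T)) + C / b) ?_)
    filter_upwards [eventually_ge_atTop T] with t ht
    have h1 := key T t le_rfl ht
    have h2 : ‖v t‖ ≤ ‖v T‖ + ‖v t - v T‖ := by
      simpa using norm_add_le (v T) (v t - v T)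
    have h3 : 1 ≤ Real.exp (-(b * T)) * Real.exp (b * t) := by
      rw [← Real.exp_add]; exact Real.one_le_exp (by nlinarith)
    have h4 : 0 ≤ C / b * Real.exp (b * T) := by positivity
    have h5 := mul_le_mul_of_nonneg_left h3 (norm_nonneg (v T))
    change ‖v t‖ ≤ _
    nlinarith

/-- Solutions of a scalar linear equation inherit the expansion of the forcing term. -/
theorem ExpApprox.of_scalar_equation [CompleteSpace W] {S : Set ℝ} {l : ℂ} (hl : l.re ∈ S)
    {w h : ℝ → W} {ρ : ℝ} (hh : ∀ ρ' < ρ, ExpApprox S h ρ')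
    (hw : ∀ᶠ t in atTop, HasDerivAt w (-(l • w t) + h t) t) : ∀ ρ' < ρ, ExpApprox S w ρ' := by
  intro ρ' hρ'
  -- Giving up a little of `ρ` avoids the exceptional rate `Re l`; this is why orders are quantified
  -- as `ρ' < ρ`.
  obtain ⟨ρ'', ⟨h1, h2⟩, h3⟩ : ∃ r ∈ Set.Ioo ρ' ρ, r ≠ l.re :=
    (Set.Ioo_infinite hρ').exists_notMem_finset {l.re} |>.imp fun r hr => by simpa using hr
  obtain ⟨p, hp, hR⟩ := hh ρ'' h2
  obtain ⟨P, hP, hd⟩ := exists_particular_solution l hp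
  have hu : ∀ᶠ t in atTop,
      HasDerivAt (fun t => w t - P t) (-(l • (w t - P t)) + (h t - p t)) t :=
    hw.mono fun t ht => (ht.sub (hd t)).congr_deriv (by rw [smul_sub]; abel)
  have := (ExpApprox.of_scalar_equation_isBigO hl h3 hR hu).add (.of_mem hP)
  simp only [sub_add_cancel] at this
  exact this.mono h1.le

/-- The product of the factors `B - l`, for `l` in a list. -/
noncomputable def factorProd (B : W →L[ℂ] W) : List ℂ → (W →L[ℂ] W)
  | [] => ContinuousLinearMap.id ℂ W
  | l :: ls => (factorProd B ls).comp (B - l • ContinuousLinearMap.id ℂ W)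

/-- `B - l` commutes with `B`, so it maps solutions to solutions of the same system with transformed
forcing. -/
theorem hasDerivAt_factor (B : W →L[ℂ] W) (l : ℂ) {w : ℝ → W} {g : W} {t : ℝ}
    (hw : HasDerivAt w (-B (w t) + g) t) :
    HasDerivAt (fun s => (B - l • ContinuousLinearMap.id ℂ W) (w s))
      (-B ((B - l • ContinuousLinearMap.id ℂ W) (w t)) +
        (B - l • ContinuousLinearMap.id ℂ W) g) t := by
  refine (((B - l • ContinuousLinearMap.id ℂ W).restrictScalars ℝ).hasFDerivAt.comp_hasDerivAt t
    hw).congr_deriv ?_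
  simp
  abel

theorem hasDerivAt_scalar_of_factor (B : W →L[ℂ] W) (l : ℂ) {w : ℝ → W} {g : W} {t : ℝ}
    (hw : HasDerivAt w (-B (w t) + g) t) :
    HasDerivAt w (-(l • w t) + (g - (B - l • ContinuousLinearMap.id ℂ W) (w t))) t := by
  refine hw.congr_deriv ?_
  simp
  abel

/-- The function `(B - l) w` solves the same system and is killed by one factor fewer, so it is
covered by induction. Then `w' = -l w + (g - (B - l) w)` is a scalar equation with known forcing. -/
theorem ExpApprox.of_linear_equation [CompleteSpace W] {S : Set ℝ} (B : W →L[ℂ] W) {ρ : ℝ}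
    (ls : List ℂ) (hls : ∀ l ∈ ls, l.re ∈ S) {w g : ℝ → W}
    (hg : ∀ ρ' < ρ, ExpApprox S g ρ') (hw : ∀ᶠ t in atTop, HasDerivAt w (-B (w t) + g t) t)
    (h0 : ∀ t, factorProd B ls (w t) = 0) : ∀ ρ' < ρ, ExpApprox S w ρ' := by
  induction ls generalizing w g with
  | nil =>
    intro ρ' _
    obtain rfl : w = 0 := funext h0
    exact .of_mem (Submodule.zero_mem _)
  | cons l ls ih =>
    have h1 := ih (fun a ha => hls a (List.mem_cons_of_mem _ ha))
      (fun ρ' hρ' => (hg ρ' hρ').clm (B - l • ContinuousLinearMap.id ℂ W))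
      (hw.mono fun t ht => hasDerivAt_factor B l ht) h0
    exact ExpApprox.of_scalar_equation (hls l List.mem_cons_self)
      (fun ρ' hρ' => (hg ρ' hρ').sub (h1 ρ' hρ'))
      (hw.mono fun t ht => hasDerivAt_scalar_of_factor B l ht)

theorem exp_mul_norm_le_of_scalar_equation {l : ℂ} {ε H s T : ℝ} (hl : ε < l.re) {w h : ℝ → W}
    (hT : Real.exp (ε * T) * ‖w T‖ ≤ H) {H' : ℝ}
    (hw : ∀ r ∈ Set.Icc T s, HasDerivAt w (-(l • w r) + h r) r)
    (hh : ∀ r ∈ Set.Icc T s, Real.exp (ε * r) * ‖h r‖ ≤ H') (hTs : T ≤ s) :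
    Real.exp (ε * s) * ‖w s‖ ≤ H + H' / (l.re - ε) := by
  have hb : 0 < l.re - ε := by linarith
  have e : ∀ r : ℝ, Real.exp (l.re * r) = Real.exp ((l.re - ε) * r) * Real.exp (ε * r) :=
    fun r => by rw [← Real.exp_add]; congr 1; ring
  have hH' : 0 ≤ H' := le_trans (by positivity) (hh T ⟨le_rfl, hTs⟩)
  have key := norm_sub_le_of_norm_deriv_le_exp (C := H') hb.ne'
    (fun r hr => hasDerivAt_integratingFactor (hw r hr)) (fun r hr => by
      rw [norm_smul, norm_exp_mul_ofReal, e, mul_assoc, mul_comm]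
      exact mul_le_mul_of_nonneg_right (hh r hr) (Real.exp_pos _).le) hTs
  have h2 : ‖Complex.exp (l * s) • w s‖ ≤ ‖Complex.exp (l * T) • w T‖ +
      ‖Complex.exp (l * s) • w s - Complex.exp (l * T) • w T‖ := by
    simpa using norm_add_le (Complex.exp (l * T) • w T)
      (Complex.exp (l * s) • w s - Complex.exp (l * T) • w T)
  rw [norm_smul, norm_smul, norm_exp_mul_ofReal, norm_exp_mul_ofReal, e, e, mul_assoc,
    mul_assoc] at h2
  have hmono : Real.exp ((l.re - ε) * T) ≤ Real.exp ((l.re - ε) * s) :=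
    Real.exp_le_exp.2 (mul_le_mul_of_nonneg_left hTs hb.le)
  have h3 : Real.exp ((l.re - ε) * T) * (Real.exp (ε * T) * ‖w T‖) ≤
      Real.exp ((l.re - ε) * s) * H :=
    mul_le_mul hmono hT (by positivity) (Real.exp_pos _).le
  have h4 : 0 ≤ H' / (l.re - ε) * Real.exp ((l.re - ε) * T) := by positivity
  refine le_of_mul_le_mul_left ?_ (Real.exp_pos ((l.re - ε) * s))
  nlinarith

/-- A priori weighted estimate for a linear equation. -/
theorem exists_weighted_bound (B : W →L[ℂ] W) {ε : ℝ} (ls : List ℂ)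
    (hls : ∀ l ∈ ls, ε < l.re) :
    ∃ K : ℝ, 0 ≤ K ∧ ∀ (w g : ℝ → W) (T s H : ℝ), T ≤ s →
      (∀ r ∈ Set.Icc T s, HasDerivAt w (-B (w r) + g r) r) →
      (∀ r, factorProd B ls (w r) = 0) →
      Real.exp (ε * T) * ‖w T‖ ≤ H →
      (∀ r ∈ Set.Icc T s, Real.exp (ε * r) * ‖g r‖ ≤ H) →
      ∀ r ∈ Set.Icc T s, Real.exp (ε * r) * ‖w r‖ ≤ K * H := by
  induction ls with
  | nil =>
    refine ⟨0, le_rfl, fun w g T s H _ _ h0 _ _ r _ => ?_⟩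
    have : w r = 0 := h0 r
    simp [this]
  | cons l ls ih =>
    obtain ⟨K, hK, hb⟩ := ih fun a ha => hls a (List.mem_cons_of_mem _ ha)
    have hl : 0 < l.re - ε := by linarith [hls l List.mem_cons_self]
    set L := B - l • ContinuousLinearMap.id ℂ W with hL
    -- The initial value contributes `H`; the scalar forcing `g - L w` has weighted size at most `(1
    -- + K * ‖L‖) * H`, and integration divides it by `l.re - ε`. The constant does not depend on
    -- the interval.
    refine ⟨1 + (1 + K * ‖L‖) / (l.re - ε), by positivity, fun w g T s H hTs hw h0 hT hg r hr => ?_⟩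
    have hLn : ∀ (r : ℝ) (x : W), Real.exp (ε * r) * ‖x‖ ≤ H →
        Real.exp (ε * r) * ‖L x‖ ≤ ‖L‖ * H := fun r x hx => by
      calc Real.exp (ε * r) * ‖L x‖ ≤ Real.exp (ε * r) * (‖L‖ * ‖x‖) :=
            mul_le_mul_of_nonneg_left (L.le_opNorm x) (Real.exp_pos _).le
        _ = ‖L‖ * (Real.exp (ε * r) * ‖x‖) := by ring
        _ ≤ _ := mul_le_mul_of_nonneg_left hx (norm_nonneg L)
    have h1 := hb (fun r => L (w r)) (fun r => L (g r)) T s (‖L‖ * H) hTs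
      (fun r hr => hasDerivAt_factor B l (hw r hr)) h0 (hLn T _ hT) fun r hr => hLn r _ (hg r hr)
    have h2 := exp_mul_norm_le_of_scalar_equation (hls l List.mem_cons_self) hT
      (H' := H + K * (‖L‖ * H)) (s := r)
      (fun q hq => hasDerivAt_scalar_of_factor B l (hw q ⟨hq.1, hq.2.trans hr.2⟩))
      (fun q hq => by
        have hq' : q ∈ Set.Icc T s := ⟨hq.1, hq.2.trans hr.2⟩
        have h3 := mul_le_mul_of_nonneg_left (norm_sub_le (g q) (L (w q)))
          (Real.exp_pos (ε * q)).le
        rw [mul_add] at h3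
        exact h3.trans (add_le_add (hg q hq') (h1 q hq'))) hr.1
    refine h2.trans_eq ?_
    ring

end LinearEquation

/-! ### Uniqueness: purely oscillating exponential polynomials that tend to zero. -/

section Uniqueness

variable {W : Type*} [NormedAddCommGroup W] [NormedSpace ℂ W]

/-- The unit translation `F ↦ F (· + 1)`. -/
def unitShift (W : Type*) [NormedAddCommGroup W] [NormedSpace ℂ W] :
    Module.End ℂ (ℝ → W) where
  toFun F t := F (t + 1)
  map_add' _ _ := rfl
  map_smul' _ _ := rfl

open Polynomial in
/-- The polynomial with the prescribed roots. -/
noncomputable def polyOfRoots (s : Multiset ℂ) : ℂ[X] := (s.map fun z => X - C z).prod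

theorem aeval_unitShift_X_sub_C (z : ℂ) (F : ℝ → W) (t : ℝ) :
    Polynomial.aeval (unitShift W) (Polynomial.X - Polynomial.C z) F t = F (t + 1) - z • F t := by
  simp [unitShift, Module.algebraMap_end_apply]

/-- If `F (t + 1) = z F t` with `‖z‖ = 1`, then `‖F‖` is constant along `t + ℕ`, so decay forces `F
= 0`. Each factor of the polynomial is thus injective on functions tending to zero. -/
theorem eq_zero_of_aeval_unitShift_eq_zero (s : Multiset ℂ) (hs : ∀ z ∈ s, ‖z‖ = 1)
    {F : ℝ → W} (hF : Tendsto F atTop (𝓝 0))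
    (h : Polynomial.aeval (unitShift W) (polyOfRoots s) F = 0) : F = 0 := by
  induction s using Multiset.induction_on generalizing F with
  | empty => simpa [polyOfRoots] using h
  | cons z s ih =>
    have hz : ‖z‖ = 1 := hs z (Multiset.mem_cons_self z s)
    have h1 : Polynomial.aeval (unitShift W) (Polynomial.X - Polynomial.C z) F = 0 := by
      refine ih (fun a ha => hs a (Multiset.mem_cons_of_mem ha)) ?_ ?_
      · have h2 := (hF.comp (tendsto_atTop_add_const_right atTop (1 : ℝ) tendsto_id)).sub
          (hF.const_smul z)
        rw [smul_zero, sub_zero] at h2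
        exact h2.congr fun t => (aeval_unitShift_X_sub_C z F t).symm
      · rw [polyOfRoots, Multiset.map_cons, Multiset.prod_cons, mul_comm, map_mul] at h
        exact h
    have h2 : ∀ t, ‖F (t + 1)‖ = ‖F t‖ := fun t => by
      have := congrFun h1 t
      rw [aeval_unitShift_X_sub_C, Pi.zero_apply, sub_eq_zero] at this
      rw [this, norm_smul, hz, one_mul]
    have h3 : ∀ (t : ℝ) (k : ℕ), ‖F (t + k)‖ = ‖F t‖ := fun t k => by
      induction k with
      | zero => simp
      | succ k ih => rw [← ih, ← h2 (t + k)]; push_cast; ring_nf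
    funext t
    have h4 : Tendsto (fun k : ℕ => ‖F (t + k)‖) atTop (𝓝 0) := by
      have := (hF.comp (tendsto_atTop_add_const_left atTop t
        (tendsto_natCast_atTop_atTop (R := ℝ)))).norm
      simpa using this
    simp only [h3] at h4
    simpa using tendsto_nhds_unique tendsto_const_nhds h4

/-- The shift minus `exp c` strictly lowers the degree in `t`, by the binomial formula. -/
theorem aeval_unitShift_expMonomial (c : ℂ) (Z : W) (M : ℕ) :
    ∀ m < M, Polynomial.aeval (unitShift W)
      ((Polynomial.X - Polynomial.C (Complex.exp c)) ^ M) (expMonomial m c Z) = 0 := by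
  induction M with
  | zero => simp
  | succ M ih =>
    intro m hm
    have h1 : Polynomial.aeval (unitShift W) (Polynomial.X - Polynomial.C (Complex.exp c))
        (expMonomial m c Z) = ∑ j ∈ Finset.range m,
          (Complex.exp c * (m.choose j : ℂ)) • expMonomial j c Z := by
      funext t
      rw [aeval_unitShift_X_sub_C, Finset.sum_apply]
      simp only [Pi.smul_apply, expMonomial, smul_smul, ← Finset.sum_smul, ← sub_smul]
      congr 1
      push_cast
      rw [add_pow, Finset.sum_range_succ, mul_add c, Complex.exp_add]
      simp only [one_pow, mul_one, Nat.choose_self, Nat.cast_one, add_mul, Finset.sum_mul]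
      rw [add_sub_assoc, sub_eq_zero.2 (by ring), add_zero]
      exact Finset.sum_congr rfl fun j _ => by ring
    rw [pow_succ, map_mul, Module.End.mul_apply, h1, map_sum]
    refine Finset.sum_eq_zero fun j hj => ?_
    rw [map_smul, ih j (by have := Finset.mem_range.1 hj; omega), smul_zero]

theorem exists_annihilating_polyOfRoots {p : ℝ → W} (hp : p ∈ expPoly {0} W) :
    ∃ s : Multiset ℂ, (∀ z ∈ s, ‖z‖ = 1) ∧
      Polynomial.aeval (unitShift W) (polyOfRoots s) p = 0 := by
  induction hp using Submodule.span_induction with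
  | mem x hx =>
    obtain ⟨m, c, Z, hc, rfl⟩ := hx
    refine ⟨Multiset.replicate (m + 1) (Complex.exp c), fun z hz => ?_, ?_⟩
    · rw [Multiset.eq_of_mem_replicate hz, Complex.norm_exp]
      simpa using hc
    · rw [polyOfRoots, Multiset.map_replicate, Multiset.prod_replicate]
      exact aeval_unitShift_expMonomial c Z (m + 1) m m.lt_succ_self
  | zero => exact ⟨0, by simp, map_zero _⟩
  | add x y _ _ hx hy =>
    obtain ⟨s, hs, h1⟩ := hx
    obtain ⟨s', hs', h2⟩ := hy
    refine ⟨s + s', fun z hz => (Multiset.mem_add.1 hz).elim (hs z) (hs' z), ?_⟩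
    rw [polyOfRoots, Multiset.map_add, Multiset.prod_add]
    change Polynomial.aeval (unitShift W) (polyOfRoots s * polyOfRoots s') _ = 0
    rw [map_add]
    -- In each summand the factor that annihilates it must act first.
    nth_rewrite 1 [mul_comm]
    rw [map_mul, map_mul, Module.End.mul_apply, Module.End.mul_apply, h1, h2, map_zero, map_zero,
      add_zero]
  | smul a x _ hx =>
    obtain ⟨s, hs, h1⟩ := hx
    exact ⟨s, hs, by rw [map_smul, h1, smul_zero]⟩

theorem expPoly_zero_eq_zero_of_tendsto {p : ℝ → W} (hp : p ∈ expPoly {0} W)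
    (h : Tendsto p atTop (𝓝 0)) : p = 0 := by
  obtain ⟨s, hs, h1⟩ := exists_annihilating_polyOfRoots hp
  exact eq_zero_of_aeval_unitShift_eq_zero s hs h h1

end Uniqueness

/-! ### S-polynomials: passage to and from complex exponentials, and gluing of approximations. -/

section SPolynomial

variable {W : Type*} [NormedAddCommGroup W] [NormedSpace ℂ W]
variable {V : Type*} [NormedAddCommGroup V] [NormedSpace ℝ V]

theorem IsSPolynomial.zero : IsSPolynomial (0 : ℝ → V) := AddSubmonoid.zero_mem _

theorem IsSPolynomial.add {p q : ℝ → V} (hp : IsSPolynomial p) (hq : IsSPolynomial q) :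
    IsSPolynomial (p + q) := AddSubmonoid.add_mem _ hp hq

theorem IsSPolynomial.cos_smul (m : ℕ) (ω : ℝ) (Z : V) :
    IsSPolynomial fun t : ℝ => (t ^ m * Real.cos (ω * t)) • Z :=
  AddSubmonoid.subset_closure ⟨m, ω, Z, .inl rfl⟩

theorem IsSPolynomial.sin_smul (m : ℕ) (ω : ℝ) (Z : V) :
    IsSPolynomial fun t : ℝ => (t ^ m * Real.sin (ω * t)) • Z :=
  AddSubmonoid.subset_closure ⟨m, ω, Z, .inr rfl⟩

theorem IsSPolynomial.neg {p : ℝ → V} (hp : IsSPolynomial p) : IsSPolynomial (-p) := by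
  induction hp using AddSubmonoid.closure_induction with
  | mem x hx =>
    obtain ⟨m, ω, Z, rfl | rfl⟩ := hx
    · convert IsSPolynomial.cos_smul m ω (-Z) using 1
      funext t; simp
    · convert IsSPolynomial.sin_smul m ω (-Z) using 1
      funext t; simp
  | zero => simpa using IsSPolynomial.zero
  | add x y _ _ hx hy => rw [neg_add]; exact hx.add hy

theorem IsSPolynomial.sub {p q : ℝ → V} (hp : IsSPolynomial p) (hq : IsSPolynomial q) :
    IsSPolynomial (p - q) := by
  rw [sub_eq_add_neg]; exact hp.add hq.neg

/-- The strict gap `ρ < a` absorbs the powers of `t`. -/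
theorem IsSPolynomial.exp_smul_isBigO {q : ℝ → V} (hq : IsSPolynomial q) {a ρ : ℝ} (h : ρ < a) :
    (fun t : ℝ => Real.exp (-a * t) • q t) =O[atTop] fun t : ℝ => Real.exp (-ρ * t) := by
  have key : ∀ (m : ℕ) (Z : V) (φ : ℝ → ℝ), (∀ t, |φ t| ≤ 1) →
      (fun t : ℝ => Real.exp (-a * t) • (t ^ m * φ t) • Z) =O[atTop]
        fun t : ℝ => Real.exp (-ρ * t) := fun m Z φ hφ => by
    have h1 : (fun t : ℝ => t ^ m) =O[atTop] fun t : ℝ => Real.exp ((a - ρ) * t) :=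
      (isLittleO_pow_exp_pos_mul_atTop (k := m) (by linarith : 0 < a - ρ)).isBigO
    have h2 : φ =O[atTop] fun _ => (1 : ℝ) :=
      IsBigO.of_bound 1 (Eventually.of_forall fun t => by simpa using hφ t)
    have h3 := (isBigO_refl (fun t : ℝ => Real.exp (-a * t)) atTop).smul
      ((h1.mul h2).smul (isBigO_const_const Z (one_ne_zero (α := ℝ)) atTop))
    refine h3.congr_right fun t => ?_
    simp only [smul_eq_mul, mul_one]
    rw [← Real.exp_add]; congr 1; ring
  induction hq using AddSubmonoid.closure_induction with
  | mem x hx =>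
    obtain ⟨m, ω, Z, rfl | rfl⟩ := hx
    · exact key m Z _ fun t => Real.abs_cos_le_one _
    · exact key m Z _ fun t => Real.abs_sin_le_one _
  | zero => simpa using isBigO_zero _ _
  | add x y _ _ hx hy => simpa only [Pi.add_apply, smul_add] using hx.add hy

theorem IsSPolynomial.exp_smul_comp_mem {q : ℝ → V} (hq : IsSPolynomial q) [NormedSpace ℝ W]
    [IsScalarTower ℝ ℂ W] (L : V →L[ℝ] W) {S : Set ℝ} {a : ℝ} (ha : a ∈ S) :
    (fun t : ℝ => Real.exp (-a * t) • L (q t)) ∈ expPoly S W := by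
  have hsm : ∀ (r : ℝ) (w : W), r • w = (r : ℂ) • w := fun r w => (algebraMap_smul ℂ r w).symm
  have hre : ∀ ω : ℝ, -(-(a : ℂ) + ω * Complex.I).re ∈ S := fun ω => by simpa using ha
  have hre' : ∀ ω : ℝ, -(-(a : ℂ) - ω * Complex.I).re ∈ S := fun ω => by simpa using ha
  induction hq using AddSubmonoid.closure_induction with
  | mem x hx =>
    obtain ⟨m, ω, Z, rfl | rfl⟩ := hx
    · convert Submodule.add_mem _
        (expMonomial_mem (m := m) ((1 / 2 : ℂ) • L Z) (hre ω))
        (expMonomial_mem (m := m) ((1 / 2 : ℂ) • L Z) (hre' ω)) using 1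
      funext t
      simp only [Pi.add_apply, expMonomial, map_smul, hsm, smul_smul, ← add_smul]
      congr 1
      push_cast
      rw [Complex.cos, show (-(a : ℂ) + ω * Complex.I) * t = -a * t + ω * t * Complex.I by ring,
        show (-(a : ℂ) - ω * Complex.I) * t = -a * t + -(ω * t) * Complex.I by ring,
        Complex.exp_add, Complex.exp_add]
      ring
    · convert Submodule.add_mem _
        (expMonomial_mem (m := m) ((-Complex.I / 2 : ℂ) • L Z) (hre ω))
        (expMonomial_mem (m := m) ((Complex.I / 2 : ℂ) • L Z) (hre' ω)) using 1
      funext t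
      simp only [Pi.add_apply, expMonomial, map_smul, hsm, smul_smul, ← add_smul]
      congr 1
      push_cast
      rw [Complex.sin, show (-(a : ℂ) + ω * Complex.I) * t = -a * t + ω * t * Complex.I by ring,
        show (-(a : ℂ) - ω * Complex.I) * t = -a * t + -(ω * t) * Complex.I by ring,
        Complex.exp_add, Complex.exp_add]
      ring
  | zero =>
    simp only [Pi.zero_apply, map_zero, smul_zero]
    exact Submodule.zero_mem _
  | add x y _ _ hx hy =>
    simp only [Pi.add_apply, map_add, smul_add]
    exact Submodule.add_mem _ hx hy

theorem IsSPolynomial.eq_zero_of_tendsto {q : ℝ → V} (hq : IsSPolynomial q) [NormedSpace ℝ W]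
    [IsScalarTower ℝ ℂ W] (L : V →L[ℝ] W) (hL : Function.Injective L)
    (h : Tendsto q atTop (𝓝 0)) : q = 0 := by
  have h1 := hq.exp_smul_comp_mem L (Set.mem_singleton (0 : ℝ))
  simp only [neg_zero, zero_mul, Real.exp_zero, one_smul] at h1
  have h2 := expPoly_zero_eq_zero_of_tendsto h1 (by
    have := (L.continuous.tendsto 0).comp h
    rwa [map_zero] at this)
  funext t
  exact hL (by simpa using congrFun h2 t)

/-- The real-linear image of an exponential polynomial, sorted by decay rates. -/
theorem exists_sPolynomial_decomposition [NormedSpace ℝ W] [IsScalarTower ℝ ℂ W]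
    (P : W →L[ℝ] V) (μ : ℕ → ℝ) {p : ℝ → W} (hp : p ∈ expPoly (Set.range μ) W) :
    ∃ q : ℕ →₀ (ℝ → V), (∀ k, IsSPolynomial (q k)) ∧
      ∀ t, P (p t) = q.sum fun k h => Real.exp (-μ k * t) • h t := by
  have hsm : ∀ (r : ℝ) (w : W), (r : ℂ) • w = r • w := fun r w => algebraMap_smul ℂ r w
  -- `P` is only real-linear while the span is complex, so the induction must carry all complex
  -- multiples.
  suffices h : ∀ a : ℂ, ∃ q : ℕ →₀ (ℝ → V), (∀ k, IsSPolynomial (q k)) ∧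
      ∀ t, P (a • p t) = q.sum fun k h => Real.exp (-μ k * t) • h t by
    simpa using h 1
  induction hp using Submodule.span_induction with
  | mem x hx =>
    obtain ⟨m, c, Z, ⟨k, hk⟩, rfl⟩ := hx
    intro a
    refine ⟨Finsupp.single k ((fun t : ℝ => (t ^ m * Real.cos (c.im * t)) • P (a • Z)) +
      fun t : ℝ => (t ^ m * Real.sin (c.im * t)) • P (Complex.I • a • Z)), fun j => ?_,
      fun t => ?_⟩
    · rw [Finsupp.single_apply]
      split_ifs
      · exact (IsSPolynomial.cos_smul _ _ _).add (IsSPolynomial.sin_smul _ _ _)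
      · exact .zero
    · rw [Finsupp.sum_single_index (by simp)]
      rw [Pi.add_apply, ← map_smul, ← map_smul, ← map_add, ← map_smul, expMonomial]
      congr 1
      rw [← hsm, ← hsm, ← hsm]
      simp only [smul_smul, ← add_smul]
      congr 1
      have hc : c * t = ((-μ k * t : ℝ) : ℂ) + ((c.im * t : ℝ) : ℂ) * Complex.I := by
        conv_lhs => rw [← Complex.re_add_im c]
        rw [hk]; push_cast; ring
      rw [hc, Complex.exp_add, Complex.exp_mul_I]
      push_cast
      ring
  | zero => exact fun a => ⟨0, fun k => .zero, by simp⟩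
  | add x y _ _ hx hy =>
    intro a
    obtain ⟨q, hq, h1⟩ := hx a
    obtain ⟨q', hq', h2⟩ := hy a
    refine ⟨q + q', fun k => (hq k).add (hq' k), fun t => ?_⟩
    rw [Pi.add_apply, smul_add, map_add, h1, h2, Finsupp.sum_add_index' (by simp) (by simp)]
  | smul b x _ hx =>
    intro a
    obtain ⟨q, hq, h1⟩ := hx (a * b)
    exact ⟨q, hq, fun t => by rw [← h1, Pi.smul_apply, smul_smul]⟩

/-- By strong induction the coefficients below `k` vanish. Multiplying by `exp (μ k t)` then shows
that `q k` tends to zero. -/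
theorem isSPolynomial_coeff_eq_zero [NormedSpace ℝ W] [IsScalarTower ℝ ℂ W] (L : V →L[ℝ] W)
    (hL : Function.Injective L) {μ : ℕ → ℝ} (hμ : StrictMono μ) {q : ℕ → ℝ → V}
    (hq : ∀ k, IsSPolynomial (q k)) {K : ℕ} {ρ : ℝ}
    (h : (fun t => ∑ k ∈ Finset.range K, Real.exp (-μ k * t) • q k t) =O[atTop]
      fun t : ℝ => Real.exp (-ρ * t)) : ∀ k < K, μ k < ρ → q k = 0 := by
  intro k
  induction k using Nat.strong_induction_on with
  | _ k ih =>
    intro hk hkρ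
    obtain ⟨r, hr1, hr2⟩ := exists_between (lt_min hkρ (hμ k.lt_succ_self))
    have hrest : (fun t => ∑ j ∈ (Finset.range K).erase k, Real.exp (-μ j * t) • q j t) =O[atTop]
        fun t : ℝ => Real.exp (-r * t) := by
      refine IsBigO.fun_sum fun j hj => ?_
      obtain ⟨hjk, hjK⟩ := Finset.mem_erase.1 hj
      rcases lt_or_gt_of_ne hjk with hlt | hgt
      · rw [ih j hlt (Finset.mem_range.1 hjK) ((hμ hlt).trans hkρ)]
        simpa using isBigO_zero _ _
      · exact (hq j).exp_smul_isBigO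
          (hr2.trans_le ((min_le_right _ _).trans (hμ.monotone hgt)))
    have hmain : (fun t => Real.exp (-μ k * t) • q k t) =O[atTop]
        fun t : ℝ => Real.exp (-r * t) := by
      refine ((h.trans (exp_isBigO_exp (hr2.le.trans (min_le_left _ _)))).sub
        hrest).congr_left fun t => ?_
      rw [← Finset.add_sum_erase _ _ (Finset.mem_range.2 hk), add_sub_cancel_right]
    have hq0 : q k =O[atTop] fun t : ℝ => Real.exp (-(r - μ k) * t) := by
      refine ((isBigO_refl (fun t : ℝ => Real.exp (μ k * t)) atTop).smul hmain).congr
        (fun t => ?_) fun t => ?_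
      · rw [smul_smul, ← Real.exp_add]; simp
      · rw [smul_eq_mul, ← Real.exp_add]; congr 1; ring
    refine (hq k).eq_zero_of_tendsto L hL (hq0.trans_tendsto ?_)
    exact Real.tendsto_exp_atBot.comp (tendsto_id.const_mul_atTop_of_neg (by linarith))

/-- By uniqueness, approximations of different orders share every coefficient whose rate lies below
both orders, so a diagonal choice gives one series. -/
theorem hasExpExpansion_of_approximations [NormedSpace ℝ W] [IsScalarTower ℝ ℂ W]
    (L : V →L[ℝ] W) (hL : Function.Injective L) {μ : ℕ → ℝ} (hμ : StrictMono μ) {y : ℝ → V}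
    (h : ∀ ρ : ℝ, ∃ q : ℕ →₀ (ℝ → V), (∀ k, IsSPolynomial (q k)) ∧
      (fun t => y t - q.sum fun k h => Real.exp (-μ k * t) • h t) =O[atTop]
        fun t : ℝ => Real.exp (-ρ * t)) :
    ∃ qhat : ℕ → ℝ → V, (∀ k, IsSPolynomial (qhat k)) ∧ HasExpExpansion y μ qhat := by
  choose q hq hO using h
  have hK : ∀ ρ ρ' : ℝ, ∀ N : ℕ, ∃ K, N ≤ K ∧ ∀ k, K ≤ k → q ρ k = 0 ∧ q ρ' k = 0 := fun ρ ρ' N => by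
    refine ⟨max N (((q ρ).support ∪ (q ρ').support).sup id + 1), le_max_left _ _, fun k hk => ?_⟩
    have hk' : k ∉ (q ρ).support ∪ (q ρ').support := fun hmem => by
      have := Finset.le_sup (f := id) hmem
      have := (le_max_right _ _).trans hk
      simp only [id] at *
      omega
    rw [Finset.mem_union, not_or, Finsupp.notMem_support_iff, Finsupp.notMem_support_iff] at hk'
    exact hk'
  have hsum : ∀ (ρ : ℝ) (K : ℕ), (∀ k, K ≤ k → q ρ k = 0) → ∀ t : ℝ,
      ((q ρ).sum fun k h => Real.exp (-μ k * t) • h t) =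
        ∑ k ∈ Finset.range K, Real.exp (-μ k * t) • q ρ k t := fun ρ K hK t => by
    refine Finsupp.sum_of_support_subset _ (fun k hk => ?_) _ (by simp)
    by_contra hk'
    exact Finsupp.mem_support_iff.1 hk (hK k (by simpa using hk'))
  have huniq : ∀ ρ ρ' : ℝ, ρ ≤ ρ' → ∀ k, μ k < ρ → q ρ k = q ρ' k := fun ρ ρ' hρ k hk => by
    obtain ⟨K, hkK, hK⟩ := hK ρ ρ' (k + 1)
    have h1 : (fun t => ∑ k ∈ Finset.range K, Real.exp (-μ k * t) • (q ρ k - q ρ' k) t) =O[atTop]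
        fun t : ℝ => Real.exp (-ρ * t) := by
      refine (((hO ρ').trans (exp_isBigO_exp hρ)).sub (hO ρ)).congr_left fun t => ?_
      rw [hsum ρ K fun k hk => (hK k hk).1, hsum ρ' K fun k hk => (hK k hk).2]
      simp only [Pi.sub_apply, smul_sub, Finset.sum_sub_distrib]
      abel
    exact sub_eq_zero.1
      (isSPolynomial_coeff_eq_zero L hL hμ (fun k => (hq ρ k).sub (hq ρ' k)) h1 k hkK hk)
  -- Order `μ (k + 1) > μ k` already determines the coefficient of index `k`.
  refine ⟨fun k => q (μ (k + 1)) k, fun k => hq _ k, fun N => ?_⟩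
  obtain ⟨ν, hν1, hν2⟩ := exists_between (hμ N.lt_succ_self)
  refine ⟨ν, hν1, ?_⟩
  -- The second order `0` is a dummy; only the first is needed here.
  obtain ⟨K, hNK, hK⟩ := hK (μ (N + 1)) 0 (N + 1)
  have htail : (fun t => ∑ k ∈ Finset.Ico (N + 1) K, Real.exp (-μ k * t) • q (μ (N + 1)) k t)
      =O[atTop] fun t : ℝ => Real.exp (-ν * t) :=
    IsBigO.fun_sum fun k hk => (hq _ k).exp_smul_isBigO
      (hν2.trans_le (hμ.monotone (Finset.mem_Ico.1 hk).1))
  refine (((hO (μ (N + 1))).trans (exp_isBigO_exp hν2.le)).add htail).congr_left fun t => ?_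
  rw [hsum _ K fun k hk => (hK k hk).1, ← Finset.sum_range_add_sum_Ico _ hNK]
  have : ∑ k ∈ Finset.range (N + 1), Real.exp (-μ k * t) • q (μ (k + 1)) k t =
      ∑ k ∈ Finset.range (N + 1), Real.exp (-μ k * t) • q (μ (N + 1)) k t :=
    Finset.sum_congr rfl fun k hk => by
      rw [huniq (μ (k + 1)) (μ (N + 1)) (hμ.monotone (Finset.mem_range.1 hk)) k
        (hμ k.lt_succ_self)]
  rw [this]
  abel

end SPolynomial

/-! ### Exponential decay of small solutions, and Cayley-Hamilton. -/

section Decay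

variable {W : Type*} [NormedAddCommGroup W] [NormedSpace ℂ W]

/-- Exponential decay of small solutions of a perturbed linear equation. -/
theorem isBigO_exp_of_perturbed_linear_equation (B : W →L[ℂ] W) {ε : ℝ} (ls : List ℂ)
    (hls : ∀ l ∈ ls, ε < l.re) {w g₁ g₂ : ℝ → W}
    (hw : ∀ᶠ t in atTop, HasDerivAt w (-B (w t) + (g₁ t + g₂ t)) t)
    (h0 : ∀ t, factorProd B ls (w t) = 0) (h1 : g₁ =o[atTop] w)
    (h2 : g₂ =O[atTop] fun t : ℝ => Real.exp (-ε * t)) :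
    w =O[atTop] fun t : ℝ => Real.exp (-ε * t) := by
  obtain ⟨K, hK, hb⟩ := exists_weighted_bound B ls hls
  obtain ⟨C, hC0, hC⟩ := h2.exists_nonneg
  -- Chosen so that `K * η ≤ 1 / 2`, which lets the contribution of `g₁` be absorbed on the left.
  have hη : (0 : ℝ) < 1 / (2 * (K + 1)) := by positivity
  obtain ⟨T, hT⟩ := eventually_atTop.1 (hw.and ((h1.bound hη).and hC.bound))
  set η := 1 / (2 * (K + 1)) with hηdef
  have hKη : K * η ≤ 1 / 2 := by
    rw [hηdef, mul_one_div, div_le_div_iff₀ (by positivity) two_pos]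
    linarith
  set φ : ℝ → ℝ := fun r => Real.exp (ε * r) * ‖w r‖ with hφ
  have hφ0 : ∀ r, 0 ≤ φ r := fun r => by positivity
  have main : ∀ s, T ≤ s → φ s ≤ 2 * (K * (φ T + C)) := fun s hs => by
    have hcont : ContinuousOn φ (Set.Icc T s) := by
      refine ContinuousOn.mul (by fun_prop) (ContinuousOn.norm fun r hr => ?_)
      exact (hT r hr.1).1.continuousAt.continuousWithinAt
    -- At a maximum point `m` of `φ` on the compact interval, `φ m ≤ K (φ T + C) + φ m / 2`, a bound
    -- independent of `s`.
    obtain ⟨m, hm, hmax⟩ := isCompact_Icc.exists_isMaxOn (Set.nonempty_Icc.2 hs) hcont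
    have hφm : ∀ r ∈ Set.Icc T s, φ r ≤ φ m := fun r hr => hmax hr
    have h3 := hb w (fun r => g₁ r + g₂ r) T s (φ T + (η * φ m + C)) hs
      (fun r hr => (hT r hr.1).1) h0
      (le_add_of_nonneg_right (by have := hφ0 m; positivity)) (fun r hr => by
        have h4 := (hT r hr.1).2.1
        have h5 := (hT r hr.1).2.2
        rw [Real.norm_eq_abs, Real.abs_exp] at h5
        have h6 : Real.exp (ε * r) * Real.exp (-ε * r) = 1 := by
          rw [← Real.exp_add]; simp
        have h7 : Real.exp (ε * r) * ‖g₁ r + g₂ r‖ ≤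
            Real.exp (ε * r) * (η * ‖w r‖ + C * Real.exp (-ε * r)) :=
          mul_le_mul_of_nonneg_left ((norm_add_le _ _).trans (add_le_add h4 h5))
            (Real.exp_pos _).le
        have h8 : Real.exp (ε * r) * (η * ‖w r‖ + C * Real.exp (-ε * r)) = η * φ r + C := by
          simp only [hφ]
          linear_combination C * h6
        have h9 := mul_le_mul_of_nonneg_left (hφm r hr) hη.le
        linarith [hφ0 T]) m hm
    have h4 : φ m ≤ K * (φ T + (η * φ m + C)) := h3
    have h5 := mul_le_mul_of_nonneg_right hKη (hφ0 m)
    have h6 := hφm s (Set.right_mem_Icc.2 hs)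
    linarith
  refine IsBigO.of_bound (2 * (K * (φ T + C))) ?_
  filter_upwards [eventually_ge_atTop T] with s hs
  rw [Real.norm_eq_abs, Real.abs_exp]
  have h3 := mul_le_mul_of_nonneg_right (main s hs) (Real.exp_pos (-ε * s)).le
  refine le_of_eq_of_le ?_ h3
  simp only [hφ]
  have h6 : Real.exp (ε * s) * Real.exp (-ε * s) = 1 := by
    rw [← Real.exp_add]; simp
  linear_combination (-‖w s‖) * h6

theorem factorProd_eq_aeval (B : W →L[ℂ] W) (ls : List ℂ) (x : W) :
    factorProd B ls x = Polynomial.aeval (B : Module.End ℂ W)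
      (ls.map fun l => Polynomial.X - Polynomial.C l).prod x := by
  induction ls generalizing x with
  | nil => simp [factorProd]
  | cons l ls ih =>
    rw [List.map_cons, List.prod_cons, mul_comm, map_mul, Module.End.mul_apply, factorProd,
      ContinuousLinearMap.comp_apply, ih]
    congr 1
    simp [Module.algebraMap_end_apply]

/-- Cayley-Hamilton: the list consists of the roots of the characteristic polynomial, with
multiplicity. -/
theorem exists_factorProd_eq_zero {n : ℕ} (M : Matrix (Fin n) (Fin n) ℂ) :
    ∃ ls : List ℂ, (∀ l ∈ ls, l ∈ spectrum ℂ M) ∧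
      ∀ x, factorProd (LinearMap.toContinuousLinearMap (Matrix.toLin' M)) ls x = 0 := by
  refine ⟨(Matrix.toLin' M).charpoly.roots.toList, fun l hl => ?_, fun x => ?_⟩
  · rw [Multiset.mem_toList] at hl
    rw [← Matrix.spectrum_toLin', Module.End.mem_spectrum_iff_isRoot_charpoly]
    exact Polynomial.isRoot_of_mem_roots hl
  · rw [factorProd_eq_aeval, ← Multiset.prod_coe, ← Multiset.map_coe, Multiset.coe_toList,
      ← (IsAlgClosed.splits _).eq_prod_roots_of_monic (LinearMap.charpoly_monic _),
      LinearMap.coe_toContinuousLinearMap, LinearMap.aeval_self_charpoly]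
    rfl

end Decay

/-! ### The nonlinearity improves the order of approximation. -/

section Nonlinearity

theorem ExpApprox.pi {n : ℕ} {S : Set ℝ} {g : ℝ → Fin n → ℂ} {ρ : ℝ}
    (h : ∀ i, ExpApprox S (fun t => g t i) ρ) : ExpApprox S g ρ := by
  have := ExpApprox.sum Finset.univ fun i _ =>
    (h i).clm (ContinuousLinearMap.single ℂ (fun _ : Fin n => ℂ) i)
  convert this using 1
  funext t
  simp [Finset.univ_sum_single]

theorem exists_eq_single_add {n k : ℕ} {d : Fin n →₀ ℕ} (hd : d.degree = k + 1) :
    ∃ i d', d = Finsupp.single i 1 + d' ∧ d'.degree = k := by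
  have hne : d ≠ 0 := fun h => by simp [h] at hd
  obtain ⟨i, hi⟩ := Finsupp.ne_iff.1 hne
  have hle : Finsupp.single i 1 ≤ d := by
    rw [Finsupp.single_le_iff]
    exact Nat.one_le_iff_ne_zero.2 hi
  refine ⟨i, d - Finsupp.single i 1, (add_tsub_cancel_of_le hle).symm, ?_⟩
  have := congrArg Finsupp.degree (add_tsub_cancel_of_le hle)
  rw [map_add, Finsupp.degree_single, hd] at this
  omega

theorem prod_pow_single_add {n : ℕ} (x : Fin n → ℂ) (i : Fin n) (d : Fin n →₀ ℕ) :
    ∏ j, x j ^ (Finsupp.single i 1 + d : Fin n →₀ ℕ) j = x i * ∏ j, x j ^ d j := by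
  classical
  simp only [Finsupp.add_apply, pow_add, Finset.prod_mul_distrib]
  congr 1
  rw [Finset.prod_eq_single i] <;> simp +contextual [eq_comm]

variable {n : ℕ} {S : Set ℝ} {ε ρ : ℝ}

theorem ExpApprox.monomial (hS : ∀ a ∈ S, ∀ b ∈ S, a + b ∈ S) (hε : 0 ≤ ε) (hερ : ε ≤ ρ)
    {g : ℝ → Fin n → ℂ} (hg : ∀ i, ExpApprox S (fun t => g t i) ρ)
    (hg' : ∀ i, (fun t => g t i) =O[atTop] fun t : ℝ => Real.exp (-ε * t)) (k : ℕ) :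
    ∀ d : Fin n →₀ ℕ, d.degree = k + 1 →
      ExpApprox S (fun t => ∏ i, g t i ^ d i) ρ ∧
        (fun t => ∏ i, g t i ^ d i) =O[atTop] fun t : ℝ => Real.exp (-ε * t) := by
  induction k with
  | zero =>
    intro d hd
    obtain ⟨i, d', rfl, hd'⟩ := exists_eq_single_add hd
    obtain rfl : d' = 0 := (Finsupp.degree_eq_zero_iff d').1 hd'
    simp only [prod_pow_single_add, Finsupp.coe_zero, Pi.zero_apply, pow_zero,
      Finset.prod_const_one, mul_one]
    exact ⟨hg i, hg' i⟩
  | succ k ih =>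
    intro d hd
    obtain ⟨i, d', rfl, hd'⟩ := exists_eq_single_add hd
    obtain ⟨h1, h2⟩ := ih d' hd'
    simp only [prod_pow_single_add]
    refine ⟨((hg i).mul hS hερ h1 (hg' i) h2).mono (by linarith), ?_⟩
    refine ((hg' i).mul h2).trans (((exp_isBigO_exp (by linarith : ε ≤ 2 * ε))).congr_left
      fun t => ?_)
    rw [← Real.exp_add]; congr 1; ring

/-- Splitting off one variable leaves a nonconstant monomial. Both factors decay like `exp (-ε t)`,
so the product gains `ε`; this gain drives the bootstrap. -/
theorem ExpApprox.monomial_of_two_le (hS : ∀ a ∈ S, ∀ b ∈ S, a + b ∈ S) (hε : 0 ≤ ε)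
    (hερ : ε ≤ ρ) {g : ℝ → Fin n → ℂ} (hg : ∀ i, ExpApprox S (fun t => g t i) ρ)
    (hg' : ∀ i, (fun t => g t i) =O[atTop] fun t : ℝ => Real.exp (-ε * t))
    {d : Fin n →₀ ℕ} (hd : 2 ≤ d.degree) :
    ExpApprox S (fun t => ∏ i, g t i ^ d i) (ρ + ε) := by
  obtain ⟨k, hk⟩ := Nat.exists_eq_add_of_le' hd
  obtain ⟨i, d', rfl, hd'⟩ := exists_eq_single_add hk
  obtain ⟨h1, h2⟩ := ExpApprox.monomial hS hε hερ hg hg' k d' hd'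
  simp only [prod_pow_single_add]
  exact (hg i).mul hS hερ h1 (hg' i) h2

/-- The inclusion of `ℝⁿ` into `ℂⁿ`. -/
noncomputable def complexify (n : ℕ) : EuclideanSpace ℝ (Fin n) →L[ℝ] (Fin n → ℂ) :=
  ContinuousLinearMap.pi fun i => Complex.ofRealCLM.comp (EuclideanSpace.proj i)

/-- The real part of a vector of `ℂⁿ`. -/
noncomputable def realPartCLM (n : ℕ) : (Fin n → ℂ) →L[ℝ] EuclideanSpace ℝ (Fin n) :=
  ((EuclideanSpace.equiv (Fin n) ℝ).symm : (Fin n → ℝ) →L[ℝ] EuclideanSpace ℝ (Fin n)).comp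
    (ContinuousLinearMap.pi fun i => Complex.reCLM.comp (ContinuousLinearMap.proj i))

theorem complexify_apply (x : EuclideanSpace ℝ (Fin n)) (i : Fin n) :
    complexify n x i = (x i : ℂ) := rfl

theorem realPartCLM_complexify (x : EuclideanSpace ℝ (Fin n)) : realPartCLM n (complexify n x) = x := by
  ext i
  simp [realPartCLM, complexify]

theorem complexify_injective : Function.Injective (complexify n) :=
  Function.LeftInverse.injective realPartCLM_complexify

theorem isBigO_complexify {α : Type*} {l : Filter α} (y : α → EuclideanSpace ℝ (Fin n)) :
    y =O[l] fun t => complexify n (y t) := by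
  simpa only [realPartCLM_complexify] using (realPartCLM n).isBigO_comp (fun t => complexify n (y t)) l

theorem complexify_toEuclideanLin (A : Matrix (Fin n) (Fin n) ℝ) (x : EuclideanSpace ℝ (Fin n)) :
    complexify n (Matrix.toEuclideanLin A x) =
      Matrix.toLin' (A.map (algebraMap ℝ ℂ)) (complexify n x) := by
  ext i
  simp [complexify_apply, Matrix.mulVec, dotProduct]

theorem eval_eq_sum_complexify (p : MvPolynomial (Fin n) ℝ) (x : EuclideanSpace ℝ (Fin n)) :
    ((MvPolynomial.eval (fun j => x j) p : ℝ) : ℂ) =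
      ∑ d ∈ p.support, ((MvPolynomial.coeff d p : ℝ) : ℂ) * ∏ i, complexify n x i ^ d i := by
  simp [MvPolynomial.eval_eq', complexify_apply]

theorem MvPolynomial.IsHomogeneous.degree_of_mem_support {p : MvPolynomial (Fin n) ℝ} {m : ℕ}
    (hp : p.IsHomogeneous m) {d : Fin n →₀ ℕ} (hd : d ∈ p.support) : d.degree = m := by
  by_contra h
  exact MvPolynomial.mem_support_iff.1 hd (hp.coeff_eq_zero h)

theorem IsHomogeneousPolynomialMap.isBigO_sq {m : ℕ} (hm : 2 ≤ m)
    {P : EuclideanSpace ℝ (Fin n) → EuclideanSpace ℝ (Fin n)}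
    (hP : IsHomogeneousPolynomialMap m P) : P =O[𝓝 0] fun x => ‖x‖ ^ 2 := by
  obtain ⟨p, hp, hPp⟩ := hP
  refine (isBigO_complexify P).trans (isBigO_pi.2 fun i => ?_)
  simp only [complexify_apply, hPp, eval_eq_sum_complexify]
  refine IsBigO.fun_sum fun d hd => IsBigO.const_mul_left (IsBigO.of_bound 1 ?_) _
  filter_upwards [Metric.ball_mem_nhds (0 : EuclideanSpace ℝ (Fin n)) one_pos] with x hx
  rw [mem_ball_zero_iff] at hx
  rw [norm_prod, one_mul, norm_pow, norm_norm]
  calc ∏ j, ‖complexify n x j ^ d j‖ ≤ ∏ j, ‖x‖ ^ d j := by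
        refine Finset.prod_le_prod (fun j _ => norm_nonneg _) fun j _ => ?_
        rw [norm_pow, complexify_apply, Complex.norm_real]
        exact pow_le_pow_left₀ (norm_nonneg _) (PiLp.norm_apply_le x j) _
    _ = ‖x‖ ^ m := by
        rw [Finset.prod_pow_eq_pow_sum, ← Finsupp.degree_eq_sum, (hp i).degree_of_mem_support hd]
    _ ≤ ‖x‖ ^ 2 := pow_le_pow_of_le_one (norm_nonneg _) hx.le hm

theorem HasPolynomialExpansionAtZero.isBigO_sq
    {G : EuclideanSpace ℝ (Fin n) → EuclideanSpace ℝ (Fin n)}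
    (hG : HasPolynomialExpansionAtZero G) : G =O[𝓝 0] fun x => ‖x‖ ^ 2 := by
  obtain ⟨Gm, hGm, h⟩ := hG
  obtain ⟨δ, hδ, hO⟩ := h 2 le_rfl
  have h1 : (fun x : EuclideanSpace ℝ (Fin n) => ‖x‖ ^ (((2 : ℕ) : ℝ) + δ)) =O[𝓝 0]
      fun x => ‖x‖ ^ 2 := by
    refine IsBigO.of_bound 1 ?_
    filter_upwards [Metric.ball_mem_nhds (0 : EuclideanSpace ℝ (Fin n)) one_pos] with x hx
    rw [mem_ball_zero_iff] at hx
    rw [one_mul, Real.norm_of_nonneg (by positivity), Real.norm_of_nonneg (by positivity),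
      ← Real.rpow_natCast]
    exact Real.rpow_le_rpow_of_exponent_ge' (norm_nonneg _) hx.le (by positivity) (by linarith)
  have h2 : (fun x => ∑ m ∈ Finset.Icc 2 2, Gm m x) =O[𝓝 0] fun x => ‖x‖ ^ 2 :=
    IsBigO.fun_sum fun m hm =>
      (hGm m (Finset.mem_Icc.1 hm).1).isBigO_sq (Finset.mem_Icc.1 hm).1
  simpa using (hO.trans h1).add h2

theorem ExpApprox.homogeneousPolynomialMap (hS : ∀ a ∈ S, ∀ b ∈ S, a + b ∈ S) (hε : 0 ≤ ε)
    (hερ : ε ≤ ρ) {y : ℝ → EuclideanSpace ℝ (Fin n)}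
    (hy : ExpApprox S (fun t => complexify n (y t)) ρ)
    (hy' : y =O[atTop] fun t : ℝ => Real.exp (-ε * t)) {m : ℕ} (hm : 2 ≤ m)
    {P : EuclideanSpace ℝ (Fin n) → EuclideanSpace ℝ (Fin n)}
    (hP : IsHomogeneousPolynomialMap m P) :
    ExpApprox S (fun t => complexify n (P (y t))) (ρ + ε) := by
  obtain ⟨p, hp, hPp⟩ := hP
  refine ExpApprox.pi fun i => ?_
  simp only [complexify_apply, hPp, eval_eq_sum_complexify]
  refine ExpApprox.sum _ fun d hd => ?_
  have h1 := ExpApprox.monomial_of_two_le hS hε hερ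
    (fun i => hy.clm (ContinuousLinearMap.proj (R := ℂ) (φ := fun _ : Fin n => ℂ) i))
    (fun i => isBigO_pi.1 (((complexify n).isBigO_comp y atTop).trans hy') i)
    (hm.trans_eq ((hp i).degree_of_mem_support hd).symm)
  simpa [complexify_apply] using h1.clm (((MvPolynomial.coeff d (p i) : ℝ) : ℂ) • ContinuousLinearMap.id ℂ ℂ)

theorem tendsto_exp_neg_mul_atTop (hε : 0 < ε) :
    Tendsto (fun t : ℝ => Real.exp (-ε * t)) atTop (𝓝 0) :=
  Real.tendsto_exp_atBot.comp (tendsto_id.const_mul_atTop_of_neg (neg_neg_of_pos hε))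

theorem ExpApprox.nonlinearity (hS : ∀ a ∈ S, ∀ b ∈ S, a + b ∈ S) (hε : 0 < ε) (hερ : ε ≤ ρ)
    {y : ℝ → EuclideanSpace ℝ (Fin n)} (hy : ExpApprox S (fun t => complexify n (y t)) ρ)
    (hy' : y =O[atTop] fun t : ℝ => Real.exp (-ε * t))
    {G : EuclideanSpace ℝ (Fin n) → EuclideanSpace ℝ (Fin n)}
    (hG : HasPolynomialExpansionAtZero G) :
    ExpApprox S (fun t => complexify n (G (y t))) (ρ + ε) := by
  obtain ⟨Gm, hGm, h⟩ := hG
  -- With `N * ε ≥ ρ + ε`, the Taylor remainder `‖y‖ ^ (N + δ)` is `O(exp (-(ρ + ε) t))`.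
  obtain ⟨N, hN⟩ := exists_nat_ge ((ρ + ε) / ε)
  obtain ⟨δ, hδ, hO⟩ := h (max 2 N) (le_max_left _ _)
  have hsum : ExpApprox S
      (fun t => ∑ m ∈ Finset.Icc 2 (max 2 N), complexify n (Gm m (y t))) (ρ + ε) :=
    ExpApprox.sum _ fun m hm => hy.homogeneousPolynomialMap hS hε.le hερ hy'
      (Finset.mem_Icc.1 hm).1 (hGm m (Finset.mem_Icc.1 hm).1)
  set r : ℝ := ((max 2 N : ℕ) : ℝ) + δ with hr
  have hr0 : 0 ≤ r := by positivity
  have hrε : ρ + ε ≤ r * ε := by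
    rw [div_le_iff₀ hε] at hN
    refine hN.trans (mul_le_mul_of_nonneg_right ?_ hε.le)
    have : (N : ℝ) ≤ ((max 2 N : ℕ) : ℝ) := Nat.cast_le.2 (le_max_right _ _)
    linarith
  have h1 : (fun t => ‖y t‖ ^ r) =O[atTop] fun t : ℝ => Real.exp (-(ρ + ε) * t) := by
    have h2 := IsBigO.rpow hr0 (Eventually.of_forall fun t => (Real.exp_pos (-ε * t)).le)
      hy'.norm_left
    refine (h2.congr_right fun t => ?_).trans (exp_isBigO_exp hrε)
    rw [← Real.exp_mul]; congr 1; ring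
  have h3 := ((complexify n).isBigO_comp _ _).trans
    ((hO.comp_tendsto (hy'.trans_tendsto (tendsto_exp_neg_mul_atTop hε))).trans h1)
  have h4 := hsum.add (.of_isBigO h3)
  refine h4.congr' (Eventually.of_forall fun t => ?_)
  simp only [Function.comp_apply, map_sub, map_sum]
  abel

end Nonlinearity

/-! ### The forcing term, and the bootstrap. -/

theorem HasExpExpansion.expApprox {n : ℕ} {μ : ℕ → ℝ} (hμ : Tendsto μ atTop atTop)
    {f : ℝ → EuclideanSpace ℝ (Fin n)} {fhat : ℕ → ℝ → EuclideanSpace ℝ (Fin n)}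
    (hfhat : ∀ k, IsSPolynomial (fhat k)) (hf : HasExpExpansion f μ fhat) (ρ : ℝ) :
    ExpApprox (Set.range μ) (fun t => complexify n (f t)) ρ := by
  obtain ⟨N, hN⟩ := (hμ.eventually_ge_atTop ρ).exists
  obtain ⟨ν, hν, hO⟩ := hf N
  have h1 := ((complexify n).isBigO_comp _ _).trans (hO.trans (exp_isBigO_exp (hN.trans hν.le)))
  have h2 : (∑ k ∈ Finset.range (N + 1), fun t : ℝ => Real.exp (-μ k * t) • complexify n (fhat k t))
      ∈ expPoly (Set.range μ) (Fin n → ℂ) :=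
    Submodule.sum_mem _ fun k _ => (hfhat k).exp_smul_comp_mem (complexify n) ⟨k, rfl⟩
  refine ⟨_, h2, h1.congr_left fun t => ?_⟩
  simp only [map_sub, map_sum, map_smul, Finset.sum_apply]

theorem HasExpExpansion.isBigO {n : ℕ} {μ : ℕ → ℝ}
    {f : ℝ → EuclideanSpace ℝ (Fin n)} {fhat : ℕ → ℝ → EuclideanSpace ℝ (Fin n)}
    (hfhat : ∀ k, IsSPolynomial (fhat k)) (hf : HasExpExpansion f μ fhat) {ε : ℝ} (hε : ε < μ 0) :
    f =O[atTop] fun t : ℝ => Real.exp (-ε * t) := by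
  obtain ⟨ν, hν, hO⟩ := hf 0
  have := (hO.trans (exp_isBigO_exp (hε.trans hν).le)).add ((hfhat 0).exp_smul_isBigO hε)
  simpa using this

end Preliminaries

theorem theorem10p11 (n : ℕ)
    -- the real matrix `A`, all of whose (complex) eigenvalues have positive real part
    (A : Matrix (Fin n) (Fin n) ℝ)
    (hA : ∀ z ∈ spectrum ℂ (A.map (algebraMap ℝ ℂ)), 0 < z.re)
    -- the nonlinearity
    (G : EuclideanSpace ℝ (Fin n) → EuclideanSpace ℝ (Fin n))
    (hGlip : LocallyLipschitz G)
    (hGexp : HasPolynomialExpansionAtZero G)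
    -- the exponents: positive, strictly increasing, divergent; the set of their values is closed
    -- under addition and contains the real parts of the eigenvalues of `A`
    (μ : ℕ → ℝ)
    (hμpos : ∀ k, 0 < μ k)
    (hμmono : StrictMono μ)
    (hμdiv : Filter.Tendsto μ Filter.atTop Filter.atTop)
    (hμadd : ∀ a ∈ Set.range μ, ∀ b ∈ Set.range μ, a + b ∈ Set.range μ)
    (hμA : ∀ z ∈ spectrum ℂ (A.map (algebraMap ℝ ℂ)), z.re ∈ Set.range μ)
    -- the forcing function
    (f : ℝ → EuclideanSpace ℝ (Fin n))
    (Tf : ℝ) (hTf : 0 ≤ Tf) (hfcont : ContinuousOn f (Set.Ici Tf))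
    (fhat : ℕ → ℝ → EuclideanSpace ℝ (Fin n))
    (hfhat : ∀ k, IsSPolynomial (fhat k))
    (hfexp : HasExpExpansion f μ fhat)
    -- the decaying solution
    (y : ℝ → EuclideanSpace ℝ (Fin n))
    (T₀ : ℝ) (hT₀ : 0 ≤ T₀) (hyC1 : ContDiffOn ℝ 1 y (Set.Ioi T₀))
    (hyode : ∀ t, T₀ < t → HasDerivAt y (-(Matrix.toEuclideanLin A (y t)) + G (y t) + f t) t)
    (hylim : Filter.Tendsto y Filter.atTop (nhds 0)) :
    ∃ qhat : ℕ → ℝ → EuclideanSpace ℝ (Fin n),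
      (∀ k, IsSPolynomial (qhat k)) ∧ HasExpExpansion y μ qhat := by
  have hμ0 : ∀ a ∈ Set.range μ, μ 0 ≤ a := by
    rintro _ ⟨k, rfl⟩
    exact hμmono.monotone k.zero_le
  have hε0 : 0 < μ 0 / 2 := half_pos (hμpos 0)
  have hεμ : μ 0 / 2 < μ 0 := half_lt_self (hμpos 0)
  -- Strictly below all rates in `S`: this leaves room for the polynomial growth of `fhat 0` and
  -- keeps every eigenvalue of `A` to the right of `ε`.
  set ε := μ 0 / 2
  obtain ⟨ls, hls, h0⟩ := exists_factorProd_eq_zero (A.map (algebraMap ℝ ℂ))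
  set B := LinearMap.toContinuousLinearMap (Matrix.toLin' (A.map (algebraMap ℝ ℂ)))
  have hw : ∀ᶠ t in Filter.atTop, HasDerivAt (fun t => complexify n (y t))
      (-B (complexify n (y t)) + (complexify n (G (y t)) + complexify n (f t))) t := by
    filter_upwards [Filter.eventually_gt_atTop T₀] with t ht
    refine ((complexify n).hasFDerivAt.comp_hasDerivAt t (hyode t ht)).congr_deriv ?_
    rw [map_add, map_add, map_neg, complexify_toEuclideanLin, add_assoc]
    rfl
  have hGo : (fun t => complexify n (G (y t))) =o[Filter.atTop] fun t => complexify n (y t) := by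
    have h1 : (fun x : EuclideanSpace ℝ (Fin n) => ‖x‖ ^ 2) =o[nhds 0] fun x => x := by
      simpa using (Asymptotics.isLittleO_norm_pow_id (E' := EuclideanSpace ℝ (Fin n)) one_lt_two)
    exact ((complexify n).isBigO_comp _ _).trans_isLittleO
      (((hGexp.isBigO_sq.trans_isLittleO h1).comp_tendsto hylim).trans_isBigO
        (isBigO_complexify y))
  have hfO := ((complexify n).isBigO_comp f Filter.atTop).trans (hfexp.isBigO hfhat hεμ)
  have hdecay := isBigO_exp_of_perturbed_linear_equation B ls
    (fun l hl => hεμ.trans_le (hμ0 _ (hμA l (hls l hl)))) hw (fun t => h0 _) hGo hfO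
  have hydecay := (isBigO_complexify y).trans hdecay
  -- Each round gains `ε` through `G`, but the linear step reaches only orders strictly below that,
  -- so `ε / 2` is recorded.
  have hiter : ∀ k : ℕ, ExpApprox (Set.range μ) (fun t => complexify n (y t))
      (ε + k * (ε / 2)) := by
    intro k
    induction k with
    | zero => simpa using ExpApprox.of_isBigO hdecay
    | succ k ih =>
      have hG := ih.nonlinearity hμadd hε0 (le_add_of_nonneg_right (by positivity)) hydecay hGexp
      refine ExpApprox.of_linear_equation B ls (fun l hl => hμA l (hls l hl))
        (fun ρ' hρ' => (hG.mono hρ'.le).add (hfexp.expApprox hμdiv hfhat ρ')) hw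
        (fun t => h0 _) _ ?_
      push_cast
      linarith
  refine hasExpExpansion_of_approximations (complexify n) complexify_injective hμmono fun ρ => ?_
  obtain ⟨k, hk⟩ := exists_nat_ge (ρ / (ε / 2))
  rw [div_le_iff₀ (half_pos hε0)] at hk
  obtain ⟨p, hp, hO⟩ := (hiter k).mono (by linarith : ρ ≤ ε + k * (ε / 2))
  obtain ⟨q, hq, hpq⟩ := exists_sPolynomial_decomposition (realPartCLM n) μ hp
  refine ⟨q, hq, (((realPartCLM n).isBigO_comp _ _).trans hO).congr_left fun t => ?_⟩
  rw [map_sub, realPartCLM_complexify, hpq]
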